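/- Let $d\in\mathbb N$, let $H,K$ be complex Hilbert spaces, and let $A=(A_1,\dots,A_d)\in\mathcal B(H)^d$ and $B=(B_1,\dots,B_d)\in\mathcal B(K)^d$. Write $S_A\subseteq\mathcal B(H)$ for the operator system generated by $A$ (the linear span of $I$, the $A_i$ and the $A_i^*$) and $C^*(S_A)$ for the unital C*-algebra generated by $A$; similarly for $B$. For a linear map $\phi$ between operator systems, $\phi$ is $n$-positive if applying it entrywise takes positive $n\times n$ matrices to positive $n \times n$ matrices, it is UCP if it is unital and $n$-positive for every $n$, and it is completely isometric if its entrywise application to $n\times n$ matrices is isometric for every $n$. For $n\ge 1$ let \[ \mathcal W_n(A)=\{(\phi(A_1),\dots,\phi(A_d)) : \phi : C^*(S_A)\to M_n(\mathbb C)\ \text{UCP}\}\subseteq M_n(\mathbb C)^d , \] and let the matrix range $\mathcal W(A)$ be the disjoint union $\bigcup_{n\ge 1}\mathcal W_n(A)$, so that containment and equality of matrix ranges are meant level by level. For a commuting tuple $B$ of normal operators let $\sigma(B)\subseteq\mathbb C^d$ be its joint spectrum, i.e. the set of all $(\chi(B_1),\dots,\chi(B_d))$ with $\chi$ a character (nonzero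 multiplicative linear functional) of $C^*(S_B)$; here $\mathbb C^d$ is identified with $M_1(\mathbb C)^d$. Then: 1. For every $n\ge 1$: if there exists a unital $n$-positive map $\phi:S_A\to S_B$ with $\phi(A_i)=B_i$ for all $i$, then $\mathcal W_n(B)\subseteq\mathcal W_n(A)$. 2. There exists a UCP map $\phi:S_A\to S_B$ with $\phi(A_i)=B_i$ for all $i$ if and only if $\mathcal W(B)\subseteq\mathcal W(A)$. If $B$ is a commuting tuple of normal operators, then $\mathcal W(B)\subseteq\mathcal W(A)$ is equivalent to $\sigma(B)\subseteq\mathcal W_1(A)$, and also equivalent to $\mathcal W_1(B)\subseteq\mathcal W_1(A)$. 3. There exists a unital completely isometric linear map $\phi:S_A\to S_B$ with $\phi(A_i)=B_i$ for all $i$ if and only if $\mathcal W(B)=\mathcal W(A)$. -/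

import Mathlib

namespace MatrixRange

/-- A (concrete) operator system on `H`: a unital, self-adjoint linear subspace of `B(H)`. -/
structure OperatorSystem (H : Type*) [NormedAddCommGroup H] [InnerProductSpace ℂ H]
    [CompleteSpace H] extends Submodule ℂ (H →L[ℂ] H) where
  one_mem' : (1 : H →L[ℂ] H) ∈ carrier
  star_mem' : ∀ {T : H →L[ℂ] H}, T ∈ carrier → star T ∈ carrier

section Block

variable {H : Type*} [NormedAddCommGroup H] [InnerProductSpace ℂ H]

/-- The operator on the Hilbert space direct sum `H ⊕ ⋯ ⊕ H` (`m` summands) given by an `m × m`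
matrix of operators on `H`; this is the standard identification `M_m(B(H)) = B(H ⊕ ⋯ ⊕ H)`. -/
noncomputable def blockOp {m : ℕ} (M : Matrix (Fin m) (Fin m) (H →L[ℂ] H)) :
    PiLp 2 (fun _ : Fin m => H) →L[ℂ] PiLp 2 (fun _ : Fin m => H) :=
  (PiLp.continuousLinearEquiv 2 ℂ (fun _ : Fin m => H)).symm.toContinuousLinearMap ∘L
    ContinuousLinearMap.pi (fun i => ∑ j, M i j ∘L PiLp.proj 2 (fun _ : Fin m => H) j)

theorem blockOp_apply {m : ℕ} (M : Matrix (Fin m) (Fin m) (H →L[ℂ] H))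
    (x : PiLp 2 (fun _ : Fin m => H)) (i : Fin m) :
    blockOp M x i = ∑ j, M i j (x j) := by
  simp [blockOp]

end Block

section Maps

variable {H : Type*} [NormedAddCommGroup H] [InnerProductSpace ℂ H] [CompleteSpace H]
variable {K : Type*} [NormedAddCommGroup K] [InnerProductSpace ℂ K] [CompleteSpace K]

/-- All of `B(H)`, as an operator system. -/
def OperatorSystem.full (H : Type*) [NormedAddCommGroup H] [InnerProductSpace ℂ H]
    [CompleteSpace H] : OperatorSystem H where
  toSubmodule := ⊤
  one_mem' := trivial
  star_mem' := fun _ => trivial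

/-- The operator `T ∈ B(H)`, as an element of the operator system `B(H)`. -/
def OperatorSystem.toFull (T : H →L[ℂ] H) : (OperatorSystem.full H).toSubmodule := ⟨T, trivial⟩

variable {S : OperatorSystem H} {T : OperatorSystem K}

/-- `φ` maps the identity to the identity. -/
def IsUnital (φ : S.toSubmodule →ₗ[ℂ] T.toSubmodule) : Prop :=
  φ ⟨1, S.one_mem'⟩ = ⟨1, T.one_mem'⟩

/-- `φ` is `m`-positive: applying `φ` entrywise maps positive `m × m` matrices over `S` to
positive matrices over `T`. -/
def IsNPositive (m : ℕ) (φ : S.toSubmodule →ₗ[ℂ] T.toSubmodule) : Prop :=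
  ∀ M : Matrix (Fin m) (Fin m) S.toSubmodule,
    (blockOp (M.map fun s => (s : H →L[ℂ] H))).IsPositive →
      (blockOp (M.map fun s => (φ s : K →L[ℂ] K))).IsPositive

/-- `φ` is unital and completely positive. -/
def IsUCP (φ : S.toSubmodule →ₗ[ℂ] T.toSubmodule) : Prop :=
  IsUnital φ ∧ ∀ m : ℕ, IsNPositive m φ

/-- `φ` is completely isometric: applying `φ` entrywise preserves the operator norm of
`m × m` matrices over `S`, for every `m`. -/
def IsCompletelyIsometric (φ : S.toSubmodule →ₗ[ℂ] T.toSubmodule) : Prop :=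
  ∀ (m : ℕ) (M : Matrix (Fin m) (Fin m) S.toSubmodule),
    ‖blockOp (M.map fun s => (φ s : K →L[ℂ] K))‖ = ‖blockOp (M.map fun s => (s : H →L[ℂ] H))‖

end Maps

section Tuples

variable {H : Type*} [NormedAddCommGroup H] [InnerProductSpace ℂ H] [CompleteSpace H] {d : ℕ}

/-- The operator system `S_A` generated by a tuple `A`: the linear span of the identity, the
operators `A i` and their adjoints. -/
noncomputable def opSystem (A : Fin d → H →L[ℂ] H) : OperatorSystem H where
  toSubmodule := Submodule.span ℂ ({1} ∪ Set.range A ∪ Set.range (fun i => star (A i)))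
  one_mem' := Submodule.subset_span (Or.inl (Or.inl rfl))
  star_mem' := by
    intro T hT
    change T ∈ Submodule.span ℂ _ at hT
    change star T ∈ Submodule.span ℂ _
    induction hT using Submodule.span_induction with
    | mem x hx =>
      apply Submodule.subset_span
      rcases hx with (hx | ⟨i, rfl⟩) | ⟨i, rfl⟩
      · rw [Set.mem_singleton_iff.1 hx, star_one]
        exact Or.inl (Or.inl rfl)
      · exact Or.inr ⟨i, rfl⟩
      · refine Or.inl (Or.inr ⟨i, ?_⟩)
        simp
    | zero => simp
    | add x y _ _ hx hy => rw [star_add]; exact Submodule.add_mem _ hx hy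
    | smul c x _ hx => rw [star_smul]; exact Submodule.smul_mem _ _ hx

/-- The operator `A i`, as an element of `S_A`. -/
noncomputable def opSystem.gen (A : Fin d → H →L[ℂ] H) (i : Fin d) : (opSystem A).toSubmodule :=
  ⟨A i, Submodule.subset_span (Or.inl (Or.inr ⟨i, rfl⟩))⟩

/-- The unital C*-algebra `C*(S_A)` generated by a tuple `A`. -/
noncomputable def cstarAlg (A : Fin d → H →L[ℂ] H) : StarSubalgebra ℂ (H →L[ℂ] H) :=
  (StarAlgebra.adjoin ℂ (Set.range A)).topologicalClosure

/-- The operator `A i`, as an element of `C*(S_A)`. -/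
noncomputable def cstarAlg.gen (A : Fin d → H →L[ℂ] H) (i : Fin d) : cstarAlg A :=
  ⟨A i, StarSubalgebra.le_topologicalClosure _ (StarAlgebra.subset_adjoin ℂ _ ⟨i, rfl⟩)⟩

/-- `C*(S_A)`, regarded as an operator system. -/
noncomputable def cstarSystem (A : Fin d → H →L[ℂ] H) : OperatorSystem H where
  toSubmodule := Subalgebra.toSubmodule (cstarAlg A).toSubalgebra
  one_mem' := one_mem (cstarAlg A)
  star_mem' := fun hT => star_mem (s := cstarAlg A) hT

/-- The operator `A i`, as an element of the operator system `C*(S_A)`. -/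
noncomputable def cstarSystem.gen (A : Fin d → H →L[ℂ] H) (i : Fin d) :
    (cstarSystem A).toSubmodule :=
  ⟨A i, (cstarAlg.gen A i).2⟩

/-- The `n`-th level `W_n(A)` of the matrix range of `A`: all tuples of `n × n` matrices
`(φ(A_1), …, φ(A_d))` with `φ : C*(S_A) → M_n` unital and completely positive. Here `M_n` is
identified with the operators on the Hilbert space `ℂⁿ` in the usual way. -/
def matrixRangeLevel (n : ℕ) (A : Fin d → H →L[ℂ] H) : Set (Fin d → Matrix (Fin n) (Fin n) ℂ) :=
  {X | ∃ φ : (cstarSystem A).toSubmodule →ₗ[ℂ]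
        (OperatorSystem.full (EuclideanSpace ℂ (Fin n))).toSubmodule,
      IsUCP φ ∧
        ∀ i, φ (cstarSystem.gen A i) = OperatorSystem.toFull (Matrix.toEuclideanCLM (𝕜 := ℂ) (X i))}

/-- The matrix range `W(A)`, the disjoint union over `n ≥ 1` of the sets `W_n(A)`. -/
def matrixRange (A : Fin d → H →L[ℂ] H) :
    Set (Σ n : ℕ+, Fin d → Matrix (Fin (n : ℕ)) (Fin (n : ℕ)) ℂ) :=
  {X | X.2 ∈ matrixRangeLevel (X.1 : ℕ) A}

/-- The joint spectrum of a commuting tuple `N` of normal operators: the set of all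
`(χ(N_1), …, χ(N_d))` where `χ` is a character of the (commutative) C*-algebra `C*(S_N)`. -/
def jointSpectrum (N : Fin d → H →L[ℂ] H) : Set (Fin d → ℂ) :=
  {z | ∃ χ : WeakDual.characterSpace ℂ (cstarAlg N), ∀ i, χ (cstarAlg.gen N i) = z i}

/-- The identification of `ℂ^d` with the `d`-tuples of `1 × 1` matrices. -/
def toOneByOne (z : Fin d → ℂ) : Fin d → Matrix (Fin 1) (Fin 1) ℂ :=
  fun i => !![z i]

end Tuples

end MatrixRange

/-! Everything reduces to one relation. For matrices `p` of degree-one star-polynomials, `Dominates`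
says that `Re p(A) ≥ 0` implies `Re p(B) ≥ 0`. Real parts (accretivity) replace positivity so that
no self-adjointness has to be carried along; positivity of `M` is accretivity of `M`, `iM` and
`-iM`. At size `n ≥ 1` the relation is exactly the existence of a unital `n`-positive map sending
`A` to `B` (`exists_isNPositive_iff`).

The key fact is `mem_matrixRangeLevel_iff`: a tuple `X` of `n × n` matrices lies in `W_n(A)` iff `A`
dominates `X` at the single size `n`. This is Arveson extension in Choi's form: the map `S_A → M_n`
is coded as a functional on `M_n(S_A)`, extended to `M_n(B(H))` by M. Riesz, and decoded as a
completely positive map. Transitivity of domination then gives inclusions of matrix ranges.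
Conversely, a failure of domination at a vector already shows in the compression of `B` to the
finite-dimensional span of its entries.

For normal commuting `B`, a matrix over `C*(S_B)` that is positive at every character is `R* R`, by
a continuous square root and Gelfand duality, so the joint spectrum decides domination at all sizes.
Complete isometries amount to domination both ways, since accretivity and norms determine each other
(`re_nonneg_of_norm_add_le`, `isAccretive_fromBlocks`). -/

namespace MatrixRange

/-! ### Accretive operator matrices and their relation to positive ones. -/

section Accretive

variable {H : Type*} [NormedAddCommGroup H] [InnerProductSpace ℂ H]
variable {ι : Type*} [Fintype ι]

/-- A matrix of operators is accretive if the real part of its quadratic form is nonnegative. -/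
def IsAccretive (M : Matrix ι ι (H →L[ℂ] H)) : Prop :=
  ∀ x : ι → H, 0 ≤ (∑ i, ∑ j, inner ℂ (x i) (M i j (x j))).re

theorem IsAccretive.add {M N : Matrix ι ι (H →L[ℂ] H)} (hM : IsAccretive M)
    (hN : IsAccretive N) : IsAccretive (M + N) := by
  intro x
  have := add_nonneg (hM x) (hN x)
  simpa only [Matrix.add_apply, add_apply, inner_add_right,
    Finset.sum_add_distrib, Complex.add_re] using this

theorem IsAccretive.smul {M : Matrix ι ι (H →L[ℂ] H)} (hM : IsAccretive M) {r : ℝ}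
    (hr : 0 ≤ r) : IsAccretive (r • M) := by
  intro x
  have := mul_nonneg hr (hM x)
  simpa only [Matrix.smul_apply, smul_apply, inner_smul_right_eq_smul,
    ← Finset.smul_sum, Complex.smul_re, smul_eq_mul] using this

theorem isAccretive_zero : IsAccretive (0 : Matrix ι ι (H →L[ℂ] H)) := by
  intro x
  simp

theorem IsAccretive.submatrix {κ : Type*} [Fintype κ] (e : κ ≃ ι) {M : Matrix ι ι (H →L[ℂ] H)}
    (h : IsAccretive M) : IsAccretive (M.submatrix e e) := by
  intro x
  have := h (x ∘ e.symm)
  rw [← e.sum_comp] at this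
  convert this using 3 with i
  rw [← e.sum_comp]
  simp

theorem isAccretive_reindex {κ : Type*} [Fintype κ] (e : κ ≃ ι) {M : Matrix ι ι (H →L[ℂ] H)} :
    IsAccretive (M.submatrix e e) ↔ IsAccretive M := by
  refine ⟨fun h => ?_, fun h => h.submatrix e⟩
  simpa using h.submatrix e.symm

theorem isAccretive_single [DecidableEq ι] (i : ι) {T : H →L[ℂ] H} :
    IsAccretive (Matrix.single i i T) ↔ ∀ x, 0 ≤ (inner ℂ x (T x)).re := by
  have key : ∀ x : ι → H,
      ∑ k, ∑ l, inner ℂ (x k) (Matrix.single i i T k l (x l)) = inner ℂ (x i) (T (x i)) := by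
    intro x
    rw [Finset.sum_eq_single i, Finset.sum_eq_single i]
    · simp
    · intro l _ hl
      simp [hl.symm]
    · simp
    · intro k _ hk
      simp [hk.symm]
    · simp
  constructor
  · intro h x
    have := h (fun _ => x)
    rwa [key] at this
  · intro h x
    rw [key]
    exact h _

theorem inner_blockOp {m : ℕ} (M : Matrix (Fin m) (Fin m) (H →L[ℂ] H))
    (x y : PiLp 2 (fun _ : Fin m => H)) :
    inner ℂ x (blockOp M y) = ∑ i, ∑ j, inner ℂ (x i) (M i j (y j)) := by
  simp only [PiLp.inner_apply, blockOp_apply, inner_sum]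

/-- The multipliers `I` and `-I` force the quadratic form to be real; `1` then gives its sign. -/
theorem isPositive_iff_re_inner (U : H →L[ℂ] H) :
    U.IsPositive ↔ ∀ c : ℂ, (c = 1 ∨ c = Complex.I ∨ c = -Complex.I) →
      ∀ x, 0 ≤ (inner ℂ x ((c • U) x)).re := by
  rw [ContinuousLinearMap.isPositive_iff_complex]
  constructor
  · intro h c hc x
    have hx := h x
    rw [← inner_conj_symm] at hx
    have h4 := congrArg Complex.im hx.1
    have h5 := hx.2
    simp only [RCLike.re_to_complex, Complex.conj_re, Complex.ofReal_im, Complex.conj_im] at h4 h5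
    rw [smul_apply, inner_smul_right]
    rcases hc with rfl | rfl | rfl <;> simp only [Complex.mul_re, Complex.neg_re, Complex.neg_im,
      Complex.I_re, Complex.I_im, Complex.one_re, Complex.one_im] <;> linarith
  · intro h x
    have h1 := h 1 (by simp) x
    have h2 := h Complex.I (by simp) x
    have h3 := h (-Complex.I) (by simp) x
    rw [smul_apply, inner_smul_right] at h1 h2 h3
    simp only [Complex.mul_re, Complex.neg_re, Complex.neg_im, Complex.I_re, Complex.I_im,
      Complex.one_re, Complex.one_im] at h1 h2 h3
    rw [← inner_conj_symm]
    simp only [RCLike.re_to_complex, Complex.conj_re]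
    refine ⟨?_, by linarith⟩
    apply Complex.ext
    · simp only [Complex.ofReal_re, Complex.conj_re]
    · simp only [Complex.ofReal_im, Complex.conj_im]
      linarith

theorem isPositive_blockOp_iff {m : ℕ} {M : Matrix (Fin m) (Fin m) (H →L[ℂ] H)} :
    (blockOp M).IsPositive ↔
      ∀ c : ℂ, (c = 1 ∨ c = Complex.I ∨ c = -Complex.I) → IsAccretive (c • M) := by
  rw [isPositive_iff_re_inner]
  refine forall₂_congr fun c _ => ?_
  simp only [IsAccretive, Matrix.smul_apply, smul_apply, inner_smul_right, ← Finset.mul_sum]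
  constructor
  · intro h x
    have := h (WithLp.toLp 2 x)
    rwa [inner_blockOp] at this
  · intro h x
    rw [inner_blockOp]
    exact h x

theorem isAccretive_of_isPositive {m : ℕ} {M : Matrix (Fin m) (Fin m) (H →L[ℂ] H)}
    (hM : (blockOp M).IsPositive) : IsAccretive M := by
  simpa using isPositive_blockOp_iff.1 hM 1 (by simp)

theorem isPositive_blockOp_single {m : ℕ} (i : Fin m) {T : H →L[ℂ] H} :
    (blockOp (Matrix.single i i T)).IsPositive ↔ T.IsPositive := by
  rw [isPositive_blockOp_iff, isPositive_iff_re_inner]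
  simp only [Matrix.smul_single, isAccretive_single]

theorem eq_zero_of_re_inner_nonneg {T : H →L[ℂ] H}
    (h : ∀ (c : ℂ) (x : H), 0 ≤ (c * inner ℂ x (T x)).re) : T = 0 := by
  have h0 : ∀ x, inner ℂ (T x) x = 0 := by
    intro x
    rw [← inner_conj_symm, map_eq_zero]
    apply Complex.ext
    · have h1 := h 1 x
      have h2 := h (-1) x
      simp at h1 h2 ⊢
      linarith
    · have h1 := h Complex.I x
      have h2 := h (-Complex.I) x
      simp at h1 h2 ⊢
      linarith
  have := (inner_map_self_eq_zero (T : H →ₗ[ℂ] H)).1 h0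
  exact ContinuousLinearMap.coe_injective this

variable [CompleteSpace H]

theorem re_form_conjTranspose (M : Matrix ι ι (H →L[ℂ] H)) (x : ι → H) :
    (∑ i, ∑ j, inner ℂ (x i) (M.conjTranspose i j (x j))).re
      = (∑ i, ∑ j, inner ℂ (x i) (M i j (x j))).re := by
  rw [Finset.sum_comm, Complex.re_sum, Complex.re_sum]
  refine Finset.sum_congr rfl fun i _ => ?_
  rw [Complex.re_sum, Complex.re_sum]
  refine Finset.sum_congr rfl fun j _ => ?_
  rw [Matrix.conjTranspose_apply, ContinuousLinearMap.star_eq_adjoint,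
    ContinuousLinearMap.adjoint_inner_right]
  exact inner_re_symm (𝕜 := ℂ) _ _

theorem isAccretive_add_conjTranspose {M : Matrix ι ι (H →L[ℂ] H)} :
    IsAccretive (M + M.conjTranspose) ↔ IsAccretive M := by
  refine forall_congr' fun x => ?_
  simp only [Matrix.add_apply, add_apply, inner_add_right,
    Finset.sum_add_distrib, Complex.add_re]
  rw [re_form_conjTranspose]
  constructor <;> intro h <;> linarith

theorem IsAccretive.isPositive_add_conjTranspose {m : ℕ}
    {M : Matrix (Fin m) (Fin m) (H →L[ℂ] H)} (h : IsAccretive M) :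
    (blockOp (M + M.conjTranspose)).IsPositive := by
  -- For imaginary `c` the matrix is skew-adjoint, so the real part of its form vanishes.
  have key : ∀ c : ℂ, star c = -c → IsAccretive (c • (M + M.conjTranspose)) := by
    intro c hc
    rw [← isAccretive_add_conjTranspose, Matrix.conjTranspose_smul, hc, Matrix.conjTranspose_add,
      Matrix.conjTranspose_conjTranspose, add_comm M.conjTranspose M, neg_smul, add_neg_cancel]
    exact isAccretive_zero
  rw [isPositive_blockOp_iff]
  rintro c (rfl | rfl | rfl)
  · simpa using isAccretive_add_conjTranspose.2 h
  · exact key _ (by simp)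
  · exact key _ (by simp)

end Accretive

/-! ### Degree-one star-polynomials and their evaluation. -/

section Evaluation

variable {d : ℕ}

/-- Coefficients of the degree one star-polynomials `c + ∑ aᵢ Xᵢ + ∑ bᵢ Xᵢ*`. -/
abbrev Coeff (d : ℕ) : Type := ℂ × (Fin d → ℂ) × (Fin d → ℂ)

/-- The coefficients of the adjoint of a degree one star-polynomial. -/
def Coeff.adj (p : Coeff d) : Coeff d := (star p.1, star p.2.2, star p.2.1)

/-- Evaluation of degree one star-polynomials at a tuple. -/
noncomputable def ev {R : Type*} [Ring R] [Algebra ℂ R] [Star R] (a : Fin d → R) :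
    Coeff d →ₗ[ℂ] R where
  toFun p := p.1 • 1 + ∑ i, p.2.1 i • a i + ∑ i, p.2.2 i • star (a i)
  map_add' p q := by
    simp only [Prod.fst_add, Prod.snd_add, Pi.add_apply, add_smul, Finset.sum_add_distrib]
    abel
  map_smul' c p := by
    simp only [Prod.smul_fst, Prod.smul_snd, Pi.smul_apply, smul_assoc, smul_add,
      Finset.smul_sum, RingHom.id_apply]

theorem ev_apply {R : Type*} [Ring R] [Algebra ℂ R] [Star R] (a : Fin d → R) (p : Coeff d) :
    ev a p = p.1 • 1 + ∑ i, p.2.1 i • a i + ∑ i, p.2.2 i • star (a i) := rfl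

theorem ev_one {R : Type*} [Ring R] [Algebra ℂ R] [Star R] (a : Fin d → R) :
    ev a (1, 0, 0) = 1 := by
  simp [ev_apply]

theorem ev_gen {R : Type*} [Ring R] [Algebra ℂ R] [Star R] (a : Fin d → R) (i : Fin d) :
    ev a (0, Pi.single i 1, 0) = a i := by
  simp [ev_apply, Pi.single_apply]

theorem ev_star {R : Type*} [Ring R] [Algebra ℂ R] [Star R] (a : Fin d → R) (i : Fin d) :
    ev a (0, 0, Pi.single i 1) = star (a i) := by
  simp [ev_apply, Pi.single_apply]

theorem ev_adj {R : Type*} [Ring R] [Algebra ℂ R] [StarRing R] [StarModule ℂ R]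
    (a : Fin d → R) (p : Coeff d) : ev a p.adj = star (ev a p) := by
  simp only [ev_apply, Coeff.adj, star_add, star_sum, star_smul, star_one, star_star,
    Pi.star_apply]
  abel

/-- A linear map which respects `1`, the generators and their adjoints respects evaluation. -/
theorem map_ev {R R' : Type*} [Ring R] [Algebra ℂ R] [Star R] [Ring R'] [Algebra ℂ R'] [Star R']
    {a : Fin d → R} {a' : Fin d → R'} (φ : R →ₗ[ℂ] R') (h1 : φ 1 = 1) (ha : ∀ i, φ (a i) = a' i)
    (hs : ∀ i, φ (star (a i)) = star (a' i)) (p : Coeff d) : φ (ev a p) = ev a' p := by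
  simp only [ev_apply, map_add, map_sum, map_smul, h1, ha, hs]

variable {ι : Type*}

/-- The entrywise adjoint transpose of a matrix of degree one star-polynomials. -/
def Coeff.matrixAdj (M : Matrix ι ι (Coeff d)) : Matrix ι ι (Coeff d) :=
  Matrix.of fun i j => (M j i).adj

theorem map_ev_matrixAdj {R : Type*} [Ring R] [Algebra ℂ R] [StarRing R] [StarModule ℂ R]
    (a : Fin d → R) (M : Matrix ι ι (Coeff d)) :
    (Coeff.matrixAdj M).map (ev a) = (M.map (ev a)).conjTranspose := by
  ext i j
  simp [Coeff.matrixAdj, ev_adj]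

end Evaluation

/-! ### Domination and the maps `p(A) ↦ p(B)` it defines. -/

section Dominates

variable {H : Type*} [NormedAddCommGroup H] [InnerProductSpace ℂ H] [CompleteSpace H]
variable {K : Type*} [NormedAddCommGroup K] [InnerProductSpace ℂ K] [CompleteSpace K]
variable {d : ℕ} {A : Fin d → H →L[ℂ] H} {B : Fin d → K →L[ℂ] K}

/-- Accretivity of an `ι × ι` matrix of degree one star-polynomials passes from `A` to `B`. -/
def Dominates (ι : Type*) [Fintype ι] (A : Fin d → H →L[ℂ] H) (B : Fin d → K →L[ℂ] K) : Prop :=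
  ∀ M : Matrix ι ι (Coeff d), IsAccretive (M.map (ev A)) → IsAccretive (M.map (ev B))

theorem Dominates.trans {ι : Type*} [Fintype ι] {L : Type*} [NormedAddCommGroup L]
    [InnerProductSpace ℂ L] [CompleteSpace L] {C : Fin d → L →L[ℂ] L} (h : Dominates ι A B)
    (h' : Dominates ι B C) : Dominates ι A C :=
  fun M hM => h' M (h M hM)

theorem Dominates.reindex {ι κ : Type*} [Fintype ι] [Fintype κ] (e : κ ≃ ι)
    (h : Dominates ι A B) : Dominates κ A B := by
  intro M hM
  have h1 := h (M.submatrix e.symm e.symm)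
  rw [← Matrix.submatrix_map, ← Matrix.submatrix_map] at h1
  exact (isAccretive_reindex e.symm).1 (h1 ((isAccretive_reindex e.symm).2 hM))

/-- Every multiple `c • p` vanishes at `A`, hence is accretive there, so the form of `p(B)` has
nonnegative real part after multiplication by any `c`. This makes `p(A) ↦ p(B)` well defined. -/
theorem Dominates.ev_eq_zero {ι : Type*} [Fintype ι] [Nonempty ι] (h : Dominates ι A B)
    {p : Coeff d} (hp : ev A p = 0) : ev B p = 0 := by
  classical
  obtain ⟨i⟩ := ‹Nonempty ι›
  apply eq_zero_of_re_inner_nonneg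
  intro c x
  have h1 := h (Matrix.single i i (c • p))
  rw [Matrix.map_single, Matrix.map_single, map_smul, map_smul, hp, smul_zero,
    Matrix.single_zero, isAccretive_single] at h1
  have := h1 isAccretive_zero x
  rwa [smul_apply, inner_smul_right] at this

theorem ev_mem_opSystem (A : Fin d → H →L[ℂ] H) (p : Coeff d) :
    ev A p ∈ (opSystem A).toSubmodule := by
  change _ ∈ Submodule.span ℂ _
  rw [ev_apply]
  refine add_mem (add_mem (Submodule.smul_mem _ _ ?_) (sum_mem fun i _ => Submodule.smul_mem _ _ ?_))
    (sum_mem fun i _ => Submodule.smul_mem _ _ ?_) <;> apply Submodule.subset_span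
  · exact Or.inl (Or.inl rfl)
  · exact Or.inl (Or.inr ⟨i, rfl⟩)
  · exact Or.inr ⟨i, rfl⟩

/-- Evaluation of degree one star-polynomials, with values in the generated operator system. -/
noncomputable def evSystem (A : Fin d → H →L[ℂ] H) : Coeff d →ₗ[ℂ] (opSystem A).toSubmodule :=
  (ev A).codRestrict _ (ev_mem_opSystem A)

theorem coe_evSystem (A : Fin d → H →L[ℂ] H) (p : Coeff d) : (evSystem A p : H →L[ℂ] H) = ev A p :=
  rfl

theorem evSystem_surjective (A : Fin d → H →L[ℂ] H) : Function.Surjective (evSystem A) := by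
  rintro ⟨T, hT⟩
  suffices T ∈ LinearMap.range (ev A) by
    obtain ⟨p, hp⟩ := this
    exact ⟨p, Subtype.ext hp⟩
  have : (opSystem A).toSubmodule ≤ LinearMap.range (ev A) := by
    change Submodule.span ℂ _ ≤ _
    rw [Submodule.span_le]
    rintro S ((hS | ⟨i, rfl⟩) | ⟨i, rfl⟩)
    · rw [Set.mem_singleton_iff.1 hS]
      exact ⟨_, ev_one A⟩
    · exact ⟨_, ev_gen A i⟩
    · exact ⟨_, ev_star A i⟩
  exact this hT

theorem evSystem_one (A : Fin d → H →L[ℂ] H) :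
    evSystem A (1, 0, 0) = ⟨1, (opSystem A).one_mem'⟩ :=
  Subtype.ext (ev_one A)

theorem evSystem_gen (A : Fin d → H →L[ℂ] H) (i : Fin d) :
    evSystem A (0, Pi.single i 1, 0) = opSystem.gen A i :=
  Subtype.ext (ev_gen A i)

/-- A map of operator systems is determined by its action on evaluations. -/
theorem exists_map_of_ev_eq_zero (h : ∀ p, ev A p = 0 → ev B p = 0) :
    ∃ φ : (opSystem A).toSubmodule →ₗ[ℂ] (opSystem B).toSubmodule,
      (∀ p, φ (evSystem A p) = evSystem B p) ∧ IsUnital φ ∧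
        ∀ i, φ (opSystem.gen A i) = opSystem.gen B i := by
  -- A linear choice of coefficients; by `h` the choice does not affect the value at `B`.
  obtain ⟨g, hg⟩ := (evSystem A).exists_rightInverse_of_surjective
    (LinearMap.range_eq_top.2 (evSystem_surjective A))
  have key : ∀ p, (evSystem B ∘ₗ g) (evSystem A p) = evSystem B p := by
    intro p
    have h1 : evSystem A (g (evSystem A p) - p) = 0 := by
      rw [map_sub, ← LinearMap.comp_apply, hg, LinearMap.id_apply, sub_self]
    have h2 := h _ (congrArg Subtype.val h1)
    rw [map_sub, sub_eq_zero] at h2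
    exact Subtype.ext h2
  refine ⟨evSystem B ∘ₗ g, key, ?_, fun i => ?_⟩
  · rw [IsUnital, ← evSystem_one, key, evSystem_one]
  · rw [← evSystem_gen, key, evSystem_gen]

theorem exists_matrix_evSystem {ι : Type*} (M : Matrix ι ι (opSystem A).toSubmodule) :
    ∃ N : Matrix ι ι (Coeff d), N.map (evSystem A) = M := by
  choose g hg using evSystem_surjective A
  exact ⟨M.map g, by ext i j; simp [hg]⟩

theorem map_coe_evSystem {ι : Type*} (N : Matrix ι ι (Coeff d)) :
    (N.map (evSystem A)).map (fun s => (s : H →L[ℂ] H)) = N.map (ev A) := rfl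

theorem Dominates.isPositive {m : ℕ} (h : Dominates (Fin m) A B)
    {N : Matrix (Fin m) (Fin m) (Coeff d)} (hN : (blockOp (N.map (ev A))).IsPositive) :
    (blockOp (N.map (ev B))).IsPositive := by
  rw [isPositive_blockOp_iff] at hN ⊢
  intro c hc
  have h1 := h (c • N)
  rw [Matrix.map_smul _ _ (map_smul (ev A) c), Matrix.map_smul _ _ (map_smul (ev B) c)] at h1
  exact h1 (hN c hc)

theorem isNPositive_of_dominates {m : ℕ} (h : Dominates (Fin m) A B)
    {φ : (opSystem A).toSubmodule →ₗ[ℂ] (opSystem B).toSubmodule}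
    (hφ : ∀ p, φ (evSystem A p) = evSystem B p) : IsNPositive m φ := by
  intro M hM
  obtain ⟨N, rfl⟩ := exists_matrix_evSystem M
  rw [map_coe_evSystem] at hM
  have : ((N.map (evSystem A)).map fun s => (φ s : K →L[ℂ] K)) = N.map (ev B) := by
    ext i j
    simp [hφ, coe_evSystem]
  rw [this]
  exact h.isPositive hM

end Dominates

end MatrixRange

namespace MatrixRange

/-! ### From positive unital maps to domination. -/

section PositiveMaps

variable {H : Type*} [NormedAddCommGroup H] [InnerProductSpace ℂ H] [CompleteSpace H]
variable {K : Type*} [NormedAddCommGroup K] [InnerProductSpace ℂ K] [CompleteSpace K]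
variable {S : OperatorSystem H} {T : OperatorSystem K} {φ : S.toSubmodule →ₗ[ℂ] T.toSubmodule}

/-- `φ` maps positive operators to positive operators. -/
def MapsPositive (φ : S.toSubmodule →ₗ[ℂ] T.toSubmodule) : Prop :=
  ∀ s : S.toSubmodule, (s : H →L[ℂ] H).IsPositive → (φ s : K →L[ℂ] K).IsPositive

theorem IsNPositive.mapsPositive {n : ℕ} (hn : 1 ≤ n) (h : IsNPositive n φ) : MapsPositive φ := by
  intro s hs
  let i : Fin n := ⟨0, hn⟩
  have h1 := h (Matrix.single i i s)
  have e1 : (Matrix.single i i s).map (fun s => (s : H →L[ℂ] H)) = Matrix.single i i ↑s :=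
    Matrix.map_single i i s S.toSubmodule.subtype
  have e2 : (Matrix.single i i s).map (fun s => (φ s : K →L[ℂ] K)) = Matrix.single i i ↑(φ s) :=
    Matrix.map_single i i s (T.toSubmodule.subtype ∘ₗ φ)
  rw [e1, e2] at h1
  rw [isPositive_blockOp_single, isPositive_blockOp_single] at h1
  exact h1 hs

theorem isSelfAdjoint_map (hu : IsUnital φ) (h : MapsPositive φ) {s : S.toSubmodule}
    (hs : IsSelfAdjoint (s : H →L[ℂ] H)) : IsSelfAdjoint (φ s : K →L[ℂ] K) := by
  let r : ℂ := (‖(s : H →L[ℂ] H)‖ : ℝ)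
  have hr : IsSelfAdjoint (r • (1 : K →L[ℂ] K)) := by
    rw [isSelfAdjoint_iff, star_smul, star_one]
    simp [r]
  have h1 : ((s + r • ⟨1, S.one_mem'⟩ : S.toSubmodule) : H →L[ℂ] H).IsPositive := by
    rw [← ContinuousLinearMap.nonneg_iff_isPositive]
    have := hs.neg_algebraMap_norm_le_self
    rw [neg_le_iff_add_nonneg] at this
    -- Adding `‖s‖ • 1` makes `s` positive, and unitality lets the shift be undone after applying
    -- `φ`.
    convert this using 2
    simp [r, Algebra.algebraMap_eq_smul_one]
  have h2 := (h _ h1).isSelfAdjoint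
  rw [map_add, map_smul, hu] at h2
  simpa using h2.sub hr

/-- The elements `s + s*` and `i(s - s*)` are self-adjoint, so their images are; solving the two
equations gives the adjoint. -/
theorem map_star_of_mapsPositive (hu : IsUnital φ) (h : MapsPositive φ) (s : S.toSubmodule) :
    (φ ⟨star (s : H →L[ℂ] H), S.star_mem' s.2⟩ : K →L[ℂ] K) = star (φ s : K →L[ℂ] K) := by
  set t : S.toSubmodule := ⟨star (s : H →L[ℂ] H), S.star_mem' s.2⟩ with ht
  have h1 : IsSelfAdjoint (φ (s + t) : K →L[ℂ] K) := isSelfAdjoint_map hu h (by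
    rw [isSelfAdjoint_iff]
    simp [ht, add_comm])
  have h2 : IsSelfAdjoint (φ (Complex.I • (s - t)) : K →L[ℂ] K) := isSelfAdjoint_map hu h (by
    rw [isSelfAdjoint_iff]
    simp [ht, smul_sub, neg_add_eq_sub])
  rw [isSelfAdjoint_iff] at h1 h2
  simp only [map_add, map_smul, map_sub, Submodule.coe_add, Submodule.coe_smul, Submodule.coe_sub,
    star_add, star_smul, star_sub, Complex.star_def, Complex.conj_I] at h1 h2
  have h3 : star (φ s : K →L[ℂ] K) - star (φ t : K →L[ℂ] K)
      = (φ t : K →L[ℂ] K) - (φ s : K →L[ℂ] K) := by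
    have := congrArg (fun U => Complex.I • U) h2
    simpa only [smul_smul, mul_neg, Complex.I_mul_I, neg_neg, one_smul, neg_smul, neg_sub,
      smul_neg] using this
  have h4 : (2 : ℂ) • star (φ s : K →L[ℂ] K) = (2 : ℂ) • (φ t : K →L[ℂ] K) := by
    rw [two_smul, two_smul, ← sub_eq_zero]
    rw [← sub_eq_zero] at h1 h3
    rw [← add_zero (0 : K →L[ℂ] K)]
    nth_rewrite 1 [← h1]
    rw [← h3]
    abel
  exact (smul_right_injective _ (two_ne_zero' ℂ) h4).symm

variable {d : ℕ} {A : Fin d → H →L[ℂ] H} {B : Fin d → K →L[ℂ] K}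

theorem coe_map_ev (hu : IsUnital φ) (h : MapsPositive φ) (hA : ∀ i, A i ∈ S.toSubmodule)
    (hev : ∀ p, ev A p ∈ S.toSubmodule) (hφ : ∀ i, (φ ⟨A i, hA i⟩ : K →L[ℂ] K) = B i)
    (p : Coeff d) : (φ ⟨ev A p, hev p⟩ : K →L[ℂ] K) = ev B p := by
  have h1 : (⟨ev A p, hev p⟩ : S.toSubmodule) = p.1 • ⟨1, S.one_mem'⟩ + ∑ i, p.2.1 i • ⟨A i, hA i⟩
      + ∑ i, p.2.2 i • ⟨star (A i), S.star_mem' (hA i)⟩ := by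
    apply Subtype.ext
    simp [ev_apply]
  have h2 : ∀ i, (φ ⟨star (A i), S.star_mem' (hA i)⟩ : K →L[ℂ] K) = star (B i) := fun i => by
    rw [← hφ i]
    exact map_star_of_mapsPositive hu h ⟨A i, hA i⟩
  rw [h1, map_add, map_add, map_sum, map_sum]
  simp only [map_smul, Submodule.coe_add, Submodule.coe_sum, Submodule.coe_smul, hφ,
    h2, ev_apply]
  rw [show φ ⟨1, S.one_mem'⟩ = ⟨1, T.one_mem'⟩ from hu]

/-- An accretive `M` has `M + M*` positive, and the adjoint can be taken on coefficients, so it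
commutes with evaluation at both tuples. -/
theorem dominates_of_isNPositive {n : ℕ} (hn : IsNPositive n φ)
    (hev : ∀ p, ev A p ∈ S.toSubmodule)
    (hφ : ∀ p, (φ ⟨ev A p, hev p⟩ : K →L[ℂ] K) = ev B p) : Dominates (Fin n) A B := by
  intro M hM
  have h1 := hM.isPositive_add_conjTranspose
  have key : ∀ {L : Type _} [NormedAddCommGroup L] [InnerProductSpace ℂ L] [CompleteSpace L]
      (C : Fin d → L →L[ℂ] L), M.map (ev C) + (M.map (ev C)).conjTranspose
        = (M + Coeff.matrixAdj M).map (ev C) := by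
    intro L _ _ _ C
    rw [← map_ev_matrixAdj, Matrix.map_add _ (map_add (ev C))]
  have h2 := hn ((M + Coeff.matrixAdj M).map fun p => ⟨ev A p, hev p⟩)
  rw [key] at h1
  have h3 := isAccretive_of_isPositive (h2 h1)
  rw [← isAccretive_add_conjTranspose, ← map_ev_matrixAdj,
    ← Matrix.map_add _ (map_add (ev B))]
  convert h3 using 1
  ext i j : 2
  simp only [Matrix.map_apply, hφ]

theorem exists_isNPositive_iff {n : ℕ} (hn : 1 ≤ n) :
    (∃ φ : (opSystem A).toSubmodule →ₗ[ℂ] (opSystem B).toSubmodule,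
        IsUnital φ ∧ IsNPositive n φ ∧ ∀ i, φ (opSystem.gen A i) = opSystem.gen B i) ↔
      Dominates (Fin n) A B := by
  constructor
  · rintro ⟨φ, hu, hp, hφ⟩
    exact dominates_of_isNPositive hp (ev_mem_opSystem A) (coe_map_ev hu (hp.mapsPositive hn)
      (fun i => (opSystem.gen A i).2) _ (fun i => congrArg Subtype.val (hφ i)))
  · intro h
    have : Nonempty (Fin n) := ⟨⟨0, hn⟩⟩
    obtain ⟨φ, hev, hu, hφ⟩ := exists_map_of_ev_eq_zero fun p hp => h.ev_eq_zero hp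
    exact ⟨φ, hu, isNPositive_of_dominates h hev, hφ⟩

theorem exists_isUCP_iff :
    (∃ φ : (opSystem A).toSubmodule →ₗ[ℂ] (opSystem B).toSubmodule,
        IsUCP φ ∧ ∀ i, φ (opSystem.gen A i) = opSystem.gen B i) ↔
      ∀ m : ℕ, Dominates (Fin m) A B := by
  constructor
  · rintro ⟨φ, ⟨hu, hp⟩, hφ⟩ m
    exact dominates_of_isNPositive (hp m) (ev_mem_opSystem A)
      (coe_map_ev hu ((hp 1).mapsPositive le_rfl)
      (fun i => (opSystem.gen A i).2) _ (fun i => congrArg Subtype.val (hφ i)))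
  · intro h
    obtain ⟨φ, hev, hu, hφ⟩ := exists_map_of_ev_eq_zero fun p hp => (h 1).ev_eq_zero hp
    exact ⟨φ, ⟨hu, fun m => isNPositive_of_dominates (h m) hev⟩, hφ⟩

theorem ev_mem_cstarSystem (A : Fin d → H →L[ℂ] H) (p : Coeff d) :
    ev A p ∈ (cstarSystem A).toSubmodule := by
  change ev A p ∈ cstarAlg A
  rw [ev_apply]
  exact add_mem (add_mem (SMulMemClass.smul_mem _ (one_mem _))
    (sum_mem fun i _ => SMulMemClass.smul_mem _ (cstarAlg.gen A i).2))
    (sum_mem fun i _ => SMulMemClass.smul_mem _ (star_mem (cstarAlg.gen A i).2))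

/-- The tuple of operators on `ℂⁿ` given by a tuple of matrices. -/
noncomputable def matrixOps {n : ℕ} (X : Fin d → Matrix (Fin n) (Fin n) ℂ) (i : Fin d) :
    EuclideanSpace ℂ (Fin n) →L[ℂ] EuclideanSpace ℂ (Fin n) :=
  Matrix.toEuclideanCLM (𝕜 := ℂ) (X i)

theorem dominates_of_mem_matrixRangeLevel {n : ℕ} {X : Fin d → Matrix (Fin n) (Fin n) ℂ}
    (hX : X ∈ matrixRangeLevel n A) (m : ℕ) : Dominates (Fin m) A (matrixOps X) := by
  obtain ⟨φ, ⟨hu, hp⟩, hφ⟩ := hX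
  exact dominates_of_isNPositive (hp m) (ev_mem_cstarSystem A)
    (coe_map_ev hu ((hp 1).mapsPositive le_rfl)
      (fun i => (cstarSystem.gen A i).2) _ (fun i => congrArg Subtype.val (hφ i)))

end PositiveMaps

end MatrixRange

namespace MatrixRange

/-! ### Extension of functionals that are nonnegative on a cone. -/

section Extension

open Complex

/-- The M. Riesz extension theorem for complex functionals with nonnegative real part on a cone,
the subspace being given as the range of a linear map. -/
theorem exists_linearMap_extension {E V : Type*} [AddCommGroup E] [Module ℂ E] [Module ℝ E]
    [IsScalarTower ℝ ℂ E] [AddCommGroup V] [Module ℂ V] [Module ℝ V] [IsScalarTower ℝ ℂ V]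
    (C : PointedCone ℝ E) (j : V →ₗ[ℂ] E) (f : V →ₗ[ℂ] ℂ)
    (hpos : ∀ v, j v ∈ C → 0 ≤ (f v).re) (hdense : ∀ y, ∃ v, j v + y ∈ C) :
    ∃ g : E →ₗ[ℂ] ℂ, (∀ v, g (j v) = f v) ∧ ∀ x ∈ C, 0 ≤ (g x).re := by
  let jr : V →ₗ[ℝ] E := j.restrictScalars ℝ
  let fr : V →ₗ[ℝ] ℝ := reLm ∘ₗ f.restrictScalars ℝ
  obtain ⟨s, hs⟩ := jr.rangeRestrict.exists_rightInverse_of_surjective jr.range_rangeRestrict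
  have hjs : ∀ x : LinearMap.range jr, j (s x) = x := fun x =>
    congrArg Subtype.val (LinearMap.congr_fun hs x)
  obtain ⟨g, hg, hgC⟩ := riesz_extension C ⟨LinearMap.range jr, fr ∘ₗ s⟩
    (fun x hx => hpos (s x) (by rwa [hjs]))
    (fun y => by
      obtain ⟨v, hv⟩ := hdense y
      exact ⟨⟨j v, v, rfl⟩, hv⟩)
  -- Both `v` and `-v` are mapped into the cone, so `Re f` factors through the range of `j`.
  have hker : ∀ v, j v = 0 → (f v).re = 0 := by
    intro v hv
    have h1 := hpos v (by rw [hv]; exact zero_mem C)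
    have h2 := hpos (-v) (by rw [map_neg, hv, neg_zero]; exact zero_mem C)
    rw [map_neg, neg_re] at h2
    linarith
  have hgj : ∀ v, g (j v) = (f v).re := by
    intro v
    have h1 := hg ⟨j v, v, rfl⟩
    have h2 := hker (s ⟨j v, v, rfl⟩ - v) (by rw [map_sub, hjs, sub_self])
    rw [map_sub, sub_re, sub_eq_zero] at h2
    rw [← h2]
    exact h1
  -- The complex functional is rebuilt from its real part as `g x - i g (i x)`.
  refine ⟨Module.Dual.extendRCLike (𝕜 := ℂ) g, fun v => ?_, fun x hx => ?_⟩
  · apply Complex.ext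
    · rw [← hgj]
      exact Module.Dual.re_extendRCLike_apply (𝕜 := ℂ) g (j v)
    · refine (Module.Dual.im_extendRCLike_apply (𝕜 := ℂ) g (j v)).trans ?_
      change -g (I • j v) = _
      rw [← map_smul, hgj]
      simp
  · exact (hgC x hx).trans_eq (Module.Dual.re_extendRCLike_apply (𝕜 := ℂ) g x).symm

end Extension

/-! ### Algebra of block operators and the accretive cone. -/

section BlockNorm

variable {H : Type*} [NormedAddCommGroup H] [InnerProductSpace ℂ H] {m : ℕ}

theorem blockOp_add (M N : Matrix (Fin m) (Fin m) (H →L[ℂ] H)) :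
    blockOp (M + N) = blockOp M + blockOp N := by
  ext x i
  simp [blockOp_apply, Finset.sum_add_distrib]

theorem blockOp_smul (c : ℂ) (M : Matrix (Fin m) (Fin m) (H →L[ℂ] H)) :
    blockOp (c • M) = c • blockOp M := by
  ext x i
  simp [blockOp_apply, Finset.smul_sum]

theorem blockOp_zero : blockOp (0 : Matrix (Fin m) (Fin m) (H →L[ℂ] H)) = 0 := by
  ext x i
  simp [blockOp_apply]

theorem blockOp_one : blockOp (1 : Matrix (Fin m) (Fin m) (H →L[ℂ] H)) = 1 := by
  ext x i
  rw [blockOp_apply, Finset.sum_eq_single i]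
  · simp
  · intro j _ hj
    simp [Matrix.one_apply_ne' hj]
  · simp

theorem isAccretive_iff_blockOp {M : Matrix (Fin m) (Fin m) (H →L[ℂ] H)} :
    IsAccretive M ↔ ∀ x, 0 ≤ (inner ℂ x (blockOp M x)).re := by
  constructor
  · intro h x
    rw [inner_blockOp]
    exact h x
  · intro h x
    have := h (WithLp.toLp 2 x)
    rwa [inner_blockOp] at this

/-- The identity is an order unit, with `c` the norm; this is the cofinality needed for the Riesz
extension. -/
theorem exists_isAccretive_smul_one_add (M : Matrix (Fin m) (Fin m) (H →L[ℂ] H)) :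
    ∃ c : ℂ, IsAccretive (c • 1 + M) := by
  refine ⟨(‖blockOp M‖ : ℝ), ?_⟩
  rw [isAccretive_iff_blockOp]
  intro x
  rw [blockOp_add, blockOp_smul, blockOp_one, add_apply, smul_apply,
    one_apply_eq_self, inner_add_right, inner_smul_right, Complex.add_re,
    Complex.re_ofReal_mul]
  have h1 : (inner ℂ x x).re = ‖x‖ ^ 2 := by
    rw [inner_self_eq_norm_sq_to_K]
    norm_cast
  have h2 := Complex.abs_re_le_norm (inner ℂ x (blockOp M x))
  have h3 := norm_inner_le_norm (𝕜 := ℂ) x (blockOp M x)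
  have h4 := mul_le_mul_of_nonneg_left ((blockOp M).le_opNorm x) (norm_nonneg x)
  have h5 := (abs_le.1 h2).1
  rw [h1]
  nlinarith

variable {d : ℕ}

theorem map_ev_diagonal {R ι : Type*} [DecidableEq ι] [Ring R] [Algebra ℂ R] [Star R]
    (a : Fin d → R) (c : ℂ) :
    (Matrix.diagonal fun _ : ι => ((c, 0, 0) : Coeff d)).map (ev a) = c • (1 : Matrix ι ι R) := by
  rw [Matrix.diagonal_map (map_zero _), ← Matrix.diagonal_one, ← Matrix.diagonal_smul]
  congr 1
  ext i
  simp [ev_apply]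

/-- The cone of accretive matrices. -/
def accretiveCone (ι H : Type*) [Fintype ι] [NormedAddCommGroup H] [InnerProductSpace ℂ H] :
    PointedCone ℝ (Matrix ι ι (H →L[ℂ] H)) where
  carrier := {M | IsAccretive M}
  add_mem' := IsAccretive.add
  zero_mem' := isAccretive_zero
  smul_mem' r _ hM := hM.smul r.2

end BlockNorm

/-! ### Arveson's extension theorem into matrices, via Choi's correspondence. -/

section Arveson

variable {n : ℕ}

theorem inner_toEuclideanCLM (N : Matrix (Fin n) (Fin n) ℂ) (x y : EuclideanSpace ℂ (Fin n)) :
    inner ℂ x (Matrix.toEuclideanCLM (𝕜 := ℂ) N y)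
      = ∑ i, ∑ j, star (x i) * y j * N i j := by
  rw [PiLp.inner_apply]
  refine Finset.sum_congr rfl fun i _ => ?_
  simp only [Matrix.ofLp_toEuclideanCLM, Matrix.mulVec, dotProduct, RCLike.inner_apply,
    Finset.sum_mul, Complex.star_def]
  refine Finset.sum_congr rfl fun j _ => ?_
  ring

theorem toEuclideanCLM_symm_apply
    (T : EuclideanSpace ℂ (Fin n) →L[ℂ] EuclideanSpace ℂ (Fin n)) (i j : Fin n) :
    (Matrix.toEuclideanCLM (𝕜 := ℂ)).symm T i j
      = inner ℂ (EuclideanSpace.single i (1 : ℂ)) (T (EuclideanSpace.single j 1)) := by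
  conv_rhs => rw [← StarAlgEquiv.apply_symm_apply (Matrix.toEuclideanCLM (n := Fin n) (𝕜 := ℂ)) T,
    inner_toEuclideanCLM]
  simp

variable {H : Type*} [NormedAddCommGroup H] [InnerProductSpace ℂ H]

/-- The map `B(H) → B(ℂⁿ)` associated with a functional on `Mₙ(B(H))`. -/
noncomputable def mapOfFunctional (g : Matrix (Fin n) (Fin n) (H →L[ℂ] H) →ₗ[ℂ] ℂ) :
    (H →L[ℂ] H) →ₗ[ℂ] (EuclideanSpace ℂ (Fin n) →L[ℂ] EuclideanSpace ℂ (Fin n)) where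
  toFun T := Matrix.toEuclideanCLM (𝕜 := ℂ) (Matrix.of fun i j => g (Matrix.single i j T))
  map_add' S T := by
    rw [← map_add]
    congr 1
    ext i j
    simp [Matrix.single_add]
  map_smul' c T := by
    rw [RingHom.id_apply, ← map_smul]
    congr 1
    ext i j
    simp [← Matrix.smul_single]

theorem sum_comm_pairs {ι κ R : Type*} [Fintype ι] [Fintype κ] [AddCommMonoid R]
    (f : ι → ι → κ → κ → R) :
    ∑ i, ∑ j, ∑ k, ∑ l, f i j k l = ∑ k, ∑ l, ∑ i, ∑ j, f i j k l := by
  have := Finset.sum_comm (s := (Finset.univ : Finset (ι × ι)))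
    (t := (Finset.univ : Finset (κ × κ))) (f := fun p q => f p.1 p.2 q.1 q.2)
  simpa only [Fintype.sum_prod_type] using this

/-- The form of an `m × m` amplification is `g` at one `n × n` matrix, a scalar compression of `M`.
Hence nonnegativity of `g` at size `n` gives complete positivity at every `m`. -/
theorem sum_inner_mapOfFunctional (g : Matrix (Fin n) (Fin n) (H →L[ℂ] H) →ₗ[ℂ] ℂ) {m : ℕ}
    (M : Matrix (Fin m) (Fin m) (H →L[ℂ] H)) (x : Fin m → EuclideanSpace ℂ (Fin n)) :
    ∑ k, ∑ l, inner ℂ (x k) (mapOfFunctional g (M k l) (x l))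
      = g (Matrix.of fun i j => ∑ k, ∑ l, (star (x k i) * x l j) • M k l) := by
  have h : ∀ Y : Matrix (Fin n) (Fin n) (H →L[ℂ] H),
      g Y = ∑ i, ∑ j, (g ∘ₗ Matrix.singleLinearMap ℂ i j) (Y i j) := by
    intro Y
    conv_lhs => rw [Matrix.matrix_eq_sum_single Y]
    simp only [map_sum]
    rfl
  rw [h]
  simp only [Matrix.of_apply, map_sum, map_smul, smul_eq_mul]
  rw [sum_comm_pairs]
  refine Finset.sum_congr rfl fun k _ => Finset.sum_congr rfl fun l _ => ?_
  exact inner_toEuclideanCLM _ _ _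

theorem isAccretive_map_mapOfFunctional {g : Matrix (Fin n) (Fin n) (H →L[ℂ] H) →ₗ[ℂ] ℂ}
    (hg : ∀ M, IsAccretive M → 0 ≤ (g M).re) {m : ℕ} {M : Matrix (Fin m) (Fin m) (H →L[ℂ] H)}
    (hM : IsAccretive M) : IsAccretive (M.map (mapOfFunctional g)) := by
  intro x
  simp only [Matrix.map_apply]
  rw [sum_inner_mapOfFunctional]
  apply hg
  intro y
  -- The form of the compressed matrix at `y` is the form of `M` at the vectors `∑ i, x k i • y i`.
  convert hM fun k => ∑ i, x k i • y i using 2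
  simp only [Matrix.of_apply, sum_apply, smul_apply, inner_sum, inner_smul_right, map_sum,
    map_smul, sum_inner, inner_smul_left, Finset.mul_sum]
  rw [sum_comm_pairs]
  refine Finset.sum_congr rfl fun k _ => Finset.sum_congr rfl fun l _ => ?_
  rw [Finset.sum_comm]
  refine Finset.sum_congr rfl fun j _ => Finset.sum_congr rfl fun i _ => ?_
  simp only [Complex.star_def]
  ring

variable [CompleteSpace H] {d : ℕ}
variable {A : Fin d → H →L[ℂ] H} {X : Fin d → Matrix (Fin n) (Fin n) ℂ}

theorem exists_completelyPositive_extension (h : Dominates (Fin n) A (matrixOps X)) :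
    ∃ ψ : (H →L[ℂ] H) →ₗ[ℂ] (EuclideanSpace ℂ (Fin n) →L[ℂ] EuclideanSpace ℂ (Fin n)),
      (∀ p, ψ (ev A p) = ev (matrixOps X) p) ∧
      ∀ (m : ℕ) (M : Matrix (Fin m) (Fin m) (H →L[ℂ] H)), IsAccretive M →
        IsAccretive (M.map ψ) := by
  let c (p : Coeff d) : Matrix (Fin n) (Fin n) ℂ :=
    (Matrix.toEuclideanCLM (𝕜 := ℂ)).symm (ev (matrixOps X) p)
  -- This is `∑ ⟨e_i, v_ij(X) e_j⟩`, the form of `v(X)` at the standard basis, so domination at size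
  -- `n` makes it nonnegative on the cone.
  let f : Matrix (Fin n) (Fin n) (Coeff d) →ₗ[ℂ] ℂ :=
    { toFun := fun v => ∑ i, ∑ j, c (v i j) i j
      map_add' := fun v w => by simp [c, Finset.sum_add_distrib]
      map_smul' := fun r v => by simp [c, Finset.mul_sum] }
  obtain ⟨g, hg, hgpos⟩ := exists_linearMap_extension (accretiveCone (Fin n) H)
    (ev A).mapMatrix f
    (fun v hv => by
      have := h v hv fun i => EuclideanSpace.single i 1
      simp only [Matrix.map_apply, ← toEuclideanCLM_symm_apply] at this
      exact this)
    (fun Y => by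
      obtain ⟨r, hr⟩ := exists_isAccretive_smul_one_add Y
      refine ⟨Matrix.diagonal fun _ => (r, 0, 0), ?_⟩
      rw [LinearMap.mapMatrix_apply, map_ev_diagonal]
      exact hr)
  refine ⟨mapOfFunctional g, fun p => ?_, fun m M => isAccretive_map_mapOfFunctional hgpos⟩
  -- Matrix units in `f` pick out single entries, so the decoded map extends `p(A) ↦ p(X)`.
  have h1 : (Matrix.of fun i j => g (Matrix.single i j (ev A p))) = c p := by
    ext i j
    rw [Matrix.of_apply, ← Matrix.map_single i j p (ev A), ← LinearMap.mapMatrix_apply, hg]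
    change ∑ k, ∑ l, c (Matrix.single i j p k l) k l = _
    rw [Finset.sum_eq_single i, Finset.sum_eq_single j]
    · simp
    · intro l _ hl
      simp [hl.symm, c]
    · simp
    · intro k _ hk
      simp [hk.symm, c]
    · simp
  change Matrix.toEuclideanCLM (𝕜 := ℂ) _ = _
  rw [h1]
  exact StarAlgEquiv.apply_symm_apply _ _

theorem mem_matrixRangeLevel_of_dominates (h : Dominates (Fin n) A (matrixOps X)) :
    X ∈ matrixRangeLevel n A := by
  obtain ⟨ψ, hev, hψ⟩ := exists_completelyPositive_extension h
  let φ : (cstarSystem A).toSubmodule →ₗ[ℂ]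
      (OperatorSystem.full (EuclideanSpace ℂ (Fin n))).toSubmodule :=
    (ψ ∘ₗ (cstarSystem A).toSubmodule.subtype).codRestrict _ fun _ => trivial
  refine ⟨φ, ⟨Subtype.ext ?_, fun m M hM => ?_⟩, fun i => Subtype.ext ?_⟩
  · change ψ 1 = 1
    rw [← ev_one A, hev, ev_one]
  · rw [isPositive_blockOp_iff] at hM ⊢
    intro c hc
    have := hψ m _ (hM c hc)
    rw [Matrix.map_smul _ _ (map_smul ψ c)] at this
    exact this
  · change ψ (A i) = matrixOps X i
    rw [← ev_gen A, hev, ev_gen]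

theorem mem_matrixRangeLevel_iff :
    X ∈ matrixRangeLevel n A ↔ Dominates (Fin n) A (matrixOps X) :=
  ⟨fun h => dominates_of_mem_matrixRangeLevel h n, mem_matrixRangeLevel_of_dominates⟩

end Arveson

end MatrixRange

namespace MatrixRange

/-! ### Finite-dimensional compressions detect domination. -/

section Compression

theorem exists_isometry_of_finite {K : Type*} [NormedAddCommGroup K]
    [InnerProductSpace ℂ K] {m : ℕ} (x : Fin m → K) (hx : x ≠ 0) :
    ∃ (n : ℕ) (_ : 1 ≤ n) (V : EuclideanSpace ℂ (Fin n) →ₗᵢ[ℂ] K)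
      (w : Fin m → EuclideanSpace ℂ (Fin n)), ∀ i, V (w i) = x i := by
  let F := Submodule.span ℂ (Set.range x)
  have hF : FiniteDimensional ℂ F := FiniteDimensional.span_of_finite ℂ (Set.finite_range x)
  have hxF : ∀ i, x i ∈ F := fun i => Submodule.subset_span ⟨i, rfl⟩
  refine ⟨Module.finrank ℂ F, ?_,
    F.subtypeₗᵢ.comp (stdOrthonormalBasis ℂ F).repr.symm.toLinearIsometry,
    fun i => (stdOrthonormalBasis ℂ F).repr ⟨x i, hxF i⟩, fun i => by simp⟩
  rw [Nat.one_le_iff_ne_zero, Ne, Submodule.finrank_eq_zero]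
  intro h0
  apply hx
  ext i
  have := hxF i
  rw [h0] at this
  simpa using this

variable {H : Type*} [NormedAddCommGroup H] [InnerProductSpace ℂ H] [CompleteSpace H]
variable {K : Type*} [NormedAddCommGroup K] [InnerProductSpace ℂ K] [CompleteSpace K]
variable {d n : ℕ} {A : Fin d → H →L[ℂ] H} {B : Fin d → K →L[ℂ] K}

/-- The compression `T ↦ V* T V` as a linear map. -/
noncomputable def compression (V : EuclideanSpace ℂ (Fin n) →ₗᵢ[ℂ] K) :
    (K →L[ℂ] K) →ₗ[ℂ] (EuclideanSpace ℂ (Fin n) →L[ℂ] EuclideanSpace ℂ (Fin n)) where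
  toFun T := V.toContinuousLinearMap.adjoint ∘L T ∘L V.toContinuousLinearMap
  map_add' S T := by ext x; simp
  map_smul' c T := by ext x; simp

theorem inner_compression (V : EuclideanSpace ℂ (Fin n) →ₗᵢ[ℂ] K) (T : K →L[ℂ] K)
    (x y : EuclideanSpace ℂ (Fin n)) :
    inner ℂ x (compression V T y) = inner ℂ (V x) (T (V y)) := by
  change inner ℂ x (V.toContinuousLinearMap.adjoint (T (V y))) = _
  rw [ContinuousLinearMap.adjoint_inner_right]
  rfl

theorem compression_one (V : EuclideanSpace ℂ (Fin n) →ₗᵢ[ℂ] K) : compression V 1 = 1 := by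
  ext1 y
  refine ext_inner_left ℂ fun x => ?_
  rw [inner_compression]
  simp

theorem compression_star (V : EuclideanSpace ℂ (Fin n) →ₗᵢ[ℂ] K) (T : K →L[ℂ] K) :
    compression V (star T) = star (compression V T) := by
  ext1 y
  refine ext_inner_left ℂ fun x => ?_
  rw [inner_compression, ContinuousLinearMap.star_eq_adjoint, ContinuousLinearMap.star_eq_adjoint,
    ContinuousLinearMap.adjoint_inner_right, ContinuousLinearMap.adjoint_inner_right,
    ← inner_conj_symm, ← inner_conj_symm _ y, inner_compression]

theorem compression_ev (V : EuclideanSpace ℂ (Fin n) →ₗᵢ[ℂ] K) (p : Coeff d) :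
    compression V (ev B p) = ev (fun i => compression V (B i)) p :=
  map_ev _ (compression_one V) (fun _ => rfl) (fun _ => compression_star V _) p

theorem dominates_compression (ι : Type*) [Fintype ι] (V : EuclideanSpace ℂ (Fin n) →ₗᵢ[ℂ] K) :
    Dominates ι B fun i => compression V (B i) := by
  intro M hM x
  have := hM (V ∘ x)
  simpa only [Matrix.map_apply, ← compression_ev, inner_compression, Function.comp_apply] using this

theorem exists_matrixOps_eq (C : Fin d → EuclideanSpace ℂ (Fin n) →L[ℂ] EuclideanSpace ℂ (Fin n)) :
    ∃ X : Fin d → Matrix (Fin n) (Fin n) ℂ, matrixOps X = C :=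
  ⟨fun i => (Matrix.toEuclideanCLM (𝕜 := ℂ)).symm (C i), funext fun _ =>
    StarAlgEquiv.apply_symm_apply _ _⟩

theorem dominates_of_matrixRangeLevel_subset
    (h : ∀ n, 1 ≤ n → matrixRangeLevel n B ⊆ matrixRangeLevel n A) (m : ℕ) :
    Dominates (Fin m) A B := by
  intro M hM x
  -- The zero vector is separate: its entries span a space of dimension `0`, and matrix ranges start
  -- at level `1`.
  by_cases hx : x = 0
  · simp [hx]
  obtain ⟨n, hn, V, w, hw⟩ := exists_isometry_of_finite x hx
  -- Compressing to the span of the entries of `x` keeps the value of the form at `x`.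
  obtain ⟨X, hX⟩ := exists_matrixOps_eq fun i => compression V (B i)
  have h1 : X ∈ matrixRangeLevel n B := by
    rw [mem_matrixRangeLevel_iff, hX]
    exact dominates_compression _ V
  have h2 := dominates_of_mem_matrixRangeLevel (h n hn h1) m M hM w
  simpa only [hX, Matrix.map_apply, ← compression_ev, inner_compression, hw] using h2

theorem matrixRange_subset_iff :
    matrixRange B ⊆ matrixRange A ↔
      ∀ n, 1 ≤ n → matrixRangeLevel n B ⊆ matrixRangeLevel n A := by
  constructor
  · intro h n hn X hX
    exact h (show (⟨⟨n, hn⟩, X⟩ : Σ n : ℕ+, Fin d → Matrix (Fin (n : ℕ)) (Fin (n : ℕ)) ℂ)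
      ∈ matrixRange B from hX)
  · rintro h ⟨n, X⟩ hX
    exact h n n.2 hX

theorem matrixRangeLevel_subset_of_dominates (h : Dominates (Fin n) A B) :
    matrixRangeLevel n B ⊆ matrixRangeLevel n A := by
  intro X hX
  rw [mem_matrixRangeLevel_iff] at hX ⊢
  exact h.trans hX

theorem matrixRange_subset_iff_dominates :
    matrixRange B ⊆ matrixRange A ↔ ∀ m : ℕ, Dominates (Fin m) A B := by
  rw [matrixRange_subset_iff]
  exact ⟨dominates_of_matrixRangeLevel_subset,
    fun h n _ => matrixRangeLevel_subset_of_dominates (h n)⟩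

end Compression

/-! ### Passing between norms and accretivity. -/

section Norm

variable {H : Type*} [NormedAddCommGroup H] [InnerProductSpace ℂ H]
variable {K : Type*} [NormedAddCommGroup K] [InnerProductSpace ℂ K]

theorem re_inner_self (x : H) : (inner ℂ x x).re = ‖x‖ ^ 2 := by
  rw [inner_self_eq_norm_sq_to_K]
  norm_cast

/-- In the expansion of `‖T x - r x‖ ^ 2` the cross term is nonpositive. -/
theorem norm_sub_smul_one_sq_le {T : H →L[ℂ] H} (hT : ∀ x, 0 ≤ (inner ℂ x (T x)).re) {r : ℝ}
    (hr : 0 ≤ r) : ‖T - (r : ℂ) • 1‖ ^ 2 ≤ ‖T‖ ^ 2 + r ^ 2 := by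
  rw [← Real.le_sqrt (norm_nonneg _) (by positivity)]
  refine ContinuousLinearMap.opNorm_le_bound _ (Real.sqrt_nonneg _) fun x => ?_
  refine le_of_sq_le_sq ?_ (by positivity)
  rw [mul_pow, Real.sq_sqrt (by positivity)]
  have h1 : ‖(T - (r : ℂ) • 1) x‖ ^ 2 = ‖T x‖ ^ 2 - 2 * (r * (inner ℂ x (T x)).re)
      + (r * ‖x‖) ^ 2 := by
    rw [sub_apply, smul_apply, one_apply_eq_self, norm_sub_sq (𝕜 := ℂ), inner_smul_right, norm_smul,
      RCLike.re_to_complex, Complex.re_ofReal_mul, Complex.norm_real, Real.norm_of_nonneg hr]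
    rw [← inner_conj_symm x (T x), Complex.conj_re]
  have h2 := T.le_opNorm x
  have h3 := mul_nonneg hr (hT x)
  have h4 : ‖T x‖ ^ 2 ≤ (‖T‖ * ‖x‖) ^ 2 := by gcongr
  rw [h1]
  nlinarith

/-- A number which lies in every disc `|z + c| ≤ ‖T + c‖` has nonnegative real part if `T` is
accretive. -/
theorem re_nonneg_of_norm_add_le {T : H →L[ℂ] H} (hT : ∀ x, 0 ≤ (inner ℂ x (T x)).re) {z : ℂ}
    (hz : ∀ c : ℂ, ‖z + c‖ ≤ ‖T + c • 1‖) : 0 ≤ z.re := by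
  by_contra! hneg
  -- Comparing `|z - r| ^ 2` with `‖T‖ ^ 2 + r ^ 2`, the `r ^ 2` cancels and a bound linear in `r`
  -- remains.
  have key : ∀ r : ℝ, 0 ≤ r → -2 * r * z.re ≤ ‖T‖ ^ 2 := by
    intro r hr
    have h1 := hz (-(r : ℂ))
    rw [neg_smul, ← sub_eq_add_neg, ← sub_eq_add_neg] at h1
    have h2 := norm_sub_smul_one_sq_le hT hr
    have h3 : ‖z - r‖ ^ 2 ≤ ‖T‖ ^ 2 + r ^ 2 := le_trans (by gcongr) h2
    rw [← Complex.normSq_eq_norm_sq, Complex.normSq_apply] at h3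
    simp only [Complex.sub_re, Complex.sub_im, Complex.ofReal_re, Complex.ofReal_im] at h3
    nlinarith [mul_self_nonneg z.re, mul_self_nonneg z.im]
  -- This `r` makes the left side equal `‖T‖ ^ 2 + 1`.
  have h1 := key ((‖T‖ ^ 2 + 1) / (-2 * z.re)) (div_nonneg (by positivity) (by linarith))
  have h2 : -2 * ((‖T‖ ^ 2 + 1) / (-2 * z.re)) * z.re = ‖T‖ ^ 2 + 1 := by
    have : z.re ≠ 0 := hneg.ne
    field_simp
  linarith

theorem re_inner_nonneg_of_norm_add_le {T : H →L[ℂ] H} {T' : K →L[ℂ] K}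
    (hT : ∀ x, 0 ≤ (inner ℂ x (T x)).re) (h : ∀ c : ℂ, ‖T' + c • 1‖ ≤ ‖T + c • 1‖) (y : K) :
    0 ≤ (inner ℂ y (T' y)).re := by
  wlog hy : ‖y‖ = 1 generalizing y
  · rcases eq_or_ne y 0 with rfl | hy0
    · simp
    have hn : ‖y‖ ≠ 0 := norm_ne_zero_iff.2 hy0
    have h1 := this (((‖y‖ : ℝ) : ℂ)⁻¹ • y) (by
      rw [norm_smul, norm_inv, Complex.norm_real, norm_norm, inv_mul_cancel₀ hn])
    rw [map_smul, inner_smul_left, inner_smul_right, ← mul_assoc, ← Complex.ofReal_inv,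
      Complex.conj_ofReal, ← Complex.ofReal_mul, Complex.re_ofReal_mul] at h1
    exact nonneg_of_mul_nonneg_right h1 (by positivity)
  · refine re_nonneg_of_norm_add_le hT fun c => ?_
    refine le_trans ?_ (h c)
    have h1 : inner ℂ y (T' y) + c = inner ℂ y ((T' + c • 1) y) := by
      rw [add_apply, smul_apply, one_apply_eq_self, inner_add_right, inner_smul_right,
        inner_self_eq_norm_sq_to_K, hy]
      simp
    rw [h1]
    have h2 := norm_inner_le_norm (𝕜 := ℂ) y ((T' + c • 1) y)
    have h3 := (T' + c • 1).le_opNorm y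
    rw [hy] at h2 h3
    linarith

theorem isAccretive_of_norm_add_le {m : ℕ} {M : Matrix (Fin m) (Fin m) (H →L[ℂ] H)}
    {N : Matrix (Fin m) (Fin m) (K →L[ℂ] K)} (hM : IsAccretive M)
    (h : ∀ c : ℂ, ‖blockOp (N + c • (1 : Matrix (Fin m) (Fin m) (K →L[ℂ] K)))‖
      ≤ ‖blockOp (M + c • (1 : Matrix (Fin m) (Fin m) (H →L[ℂ] H)))‖) : IsAccretive N := by
  rw [isAccretive_iff_blockOp] at hM ⊢
  refine re_inner_nonneg_of_norm_add_le hM fun c => ?_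
  simpa only [blockOp_add, blockOp_smul, blockOp_one] using h c

theorem norm_le_of_forall_re_nonneg {T : H →L[ℂ] H} {r : ℝ} (hr : 0 < r)
    (h : ∀ x y, 0 ≤ r * ‖x‖ ^ 2 + 2 * (inner ℂ x (T y)).re + r * ‖y‖ ^ 2) : ‖T‖ ≤ r := by
  refine ContinuousLinearMap.opNorm_le_bound _ hr.le fun y => ?_
  refine le_of_sq_le_sq ?_ (by positivity)
  -- These vectors reduce the form to `r * ((r‖y‖) ^ 2 - ‖T y‖ ^ 2)`.
  have h1 := h (-T y) ((r : ℂ) • y)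
  rw [norm_neg, map_smul, inner_neg_left, inner_smul_right, Complex.neg_re, Complex.re_ofReal_mul,
    re_inner_self, norm_smul, Complex.norm_real, Real.norm_of_nonneg hr.le] at h1
  have h2 : 0 ≤ r * ((r * ‖y‖) ^ 2 - ‖T y‖ ^ 2) := by linarith
  have := nonneg_of_mul_nonneg_right h2 hr
  linarith

theorem re_nonneg_of_norm_le {T : H →L[ℂ] H} {r : ℝ} (h : ‖T‖ ≤ r) (x y : H) :
    0 ≤ r * ‖x‖ ^ 2 + 2 * (inner ℂ x (T y)).re + r * ‖y‖ ^ 2 := by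
  have h1 := (abs_le.1 ((Complex.abs_re_le_norm _).trans (norm_inner_le_norm (𝕜 := ℂ) x (T y)))).1
  have h2 : ‖x‖ * ‖T y‖ ≤ ‖x‖ * (r * ‖y‖) :=
    mul_le_mul_of_nonneg_left (T.le_of_opNorm_le h y) (norm_nonneg x)
  have h3 : 0 ≤ r * (‖x‖ - ‖y‖) ^ 2 := mul_nonneg ((norm_nonneg T).trans h) (sq_nonneg _)
  nlinarith

/-- Only the real part matters, so this triangular matrix replaces the usual one with rows `(r, M)`
and `(M*, r)`, and no adjoint is needed. -/
theorem isAccretive_fromBlocks {m : ℕ} {M : Matrix (Fin m) (Fin m) (H →L[ℂ] H)} {r : ℝ} :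
    IsAccretive (Matrix.fromBlocks ((r : ℂ) • 1) ((2 : ℂ) • M) 0 ((r : ℂ) • 1)) ↔
      ∀ x y, 0 ≤ r * ‖x‖ ^ 2 + 2 * (inner ℂ x (blockOp M y)).re + r * ‖y‖ ^ 2 := by
  have key : ∀ x y : PiLp 2 (fun _ : Fin m => H),
      (∑ i, ∑ j, inner ℂ (Sum.elim x.ofLp y.ofLp i)
        (Matrix.fromBlocks ((r : ℂ) • 1) ((2 : ℂ) • M) 0 ((r : ℂ) • 1) i j
          (Sum.elim x.ofLp y.ofLp j))).re
        = r * ‖x‖ ^ 2 + 2 * (inner ℂ x (blockOp M y)).re + r * ‖y‖ ^ 2 := by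
    intro x y
    simp only [Fintype.sum_sum_type, Sum.elim_inl, Sum.elim_inr, Matrix.fromBlocks_apply₁₁,
      Matrix.fromBlocks_apply₁₂, Matrix.fromBlocks_apply₂₁, Matrix.fromBlocks_apply₂₂,
      Finset.sum_add_distrib, ← inner_blockOp, blockOp_smul, blockOp_one]
    simp only [blockOp_zero, zero_apply, inner_zero_right, smul_apply, one_apply_eq_self,
      inner_smul_right, Complex.add_re, Complex.re_ofReal_mul, re_inner_self]
    simp [add_assoc]
  constructor
  · intro h x y
    rw [← key]
    exact h _
  · intro h x
    have := h (WithLp.toLp 2 (x ∘ Sum.inl)) (WithLp.toLp 2 (x ∘ Sum.inr))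
    rw [← key] at this
    simpa only [Sum.elim_comp_inl_inr] using this

end Norm

/-! ### Complete isometries as two-sided domination. -/

section CompleteIsometry

variable {H : Type*} [NormedAddCommGroup H] [InnerProductSpace ℂ H] [CompleteSpace H]
variable {K : Type*} [NormedAddCommGroup K] [InnerProductSpace ℂ K] [CompleteSpace K]
variable {d : ℕ} {A : Fin d → H →L[ℂ] H} {B : Fin d → K →L[ℂ] K}

theorem norm_blockOp_le_of_dominates (h : ∀ m : ℕ, Dominates (Fin m) A B) {m : ℕ}
    (M : Matrix (Fin m) (Fin m) (Coeff d)) :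
    ‖blockOp (M.map (ev B))‖ ≤ ‖blockOp (M.map (ev A))‖ := by
  refine le_of_forall_pos_le_add fun ε hε => ?_
  -- The `ε` keeps `r` positive even when the norm is zero.
  set r : ℝ := ‖blockOp (M.map (ev A))‖ + ε with hr
  have hr0 : 0 < r := by positivity
  have hd : Dominates (Fin m ⊕ Fin m) A B := (h (m + m)).reindex finSumFinEquiv
  let D : Matrix (Fin m) (Fin m) (Coeff d) := Matrix.diagonal fun _ => ((r : ℂ), 0, 0)
  have h1 := hd (Matrix.fromBlocks D ((2 : ℂ) • M) 0 D)
  simp only [Matrix.fromBlocks_map, D, map_ev_diagonal, Matrix.map_zero _ (map_zero (ev _)),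
    Matrix.map_smul _ _ (map_smul (ev _) (2 : ℂ)), isAccretive_fromBlocks] at h1
  exact norm_le_of_forall_re_nonneg hr0 (h1 (re_nonneg_of_norm_le (by linarith)))

theorem dominates_of_norm_blockOp_le {m : ℕ}
    (h : ∀ M : Matrix (Fin m) (Fin m) (Coeff d),
      ‖blockOp (M.map (ev B))‖ ≤ ‖blockOp (M.map (ev A))‖) : Dominates (Fin m) A B := by
  intro M hM
  refine isAccretive_of_norm_add_le hM fun c => ?_
  have := h (M + Matrix.diagonal fun _ => (c, 0, 0))
  rwa [Matrix.map_add _ (map_add _), Matrix.map_add _ (map_add _), map_ev_diagonal,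
    map_ev_diagonal] at this

theorem IsCompletelyIsometric.isNPositive {S : OperatorSystem H} {T : OperatorSystem K}
    {φ : S.toSubmodule →ₗ[ℂ] T.toSubmodule} (hu : IsUnital φ) (h : IsCompletelyIsometric φ)
    (m : ℕ) : IsNPositive m φ := by
  intro M hM
  rw [isPositive_blockOp_iff] at hM ⊢
  intro c hc
  refine isAccretive_of_norm_add_le (hM c hc) fun r => le_of_eq ?_
  convert h m (c • M + r • Matrix.diagonal fun _ => ⟨1, S.one_mem'⟩) using 3
  · ext i j : 2
    rcases eq_or_ne i j with rfl | hij
    · simp [show φ ⟨1, S.one_mem'⟩ = ⟨1, T.one_mem'⟩ from hu]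
    · simp [hij]
  · ext i j : 2
    rcases eq_or_ne i j with rfl | hij
    · simp
    · simp [hij]

theorem exists_completelyIsometric_iff :
    (∃ φ : (opSystem A).toSubmodule →ₗ[ℂ] (opSystem B).toSubmodule,
        IsUnital φ ∧ IsCompletelyIsometric φ ∧ ∀ i, φ (opSystem.gen A i) = opSystem.gen B i) ↔
      matrixRange B = matrixRange A := by
  rw [Set.Subset.antisymm_iff, matrixRange_subset_iff_dominates, matrixRange_subset_iff_dominates]
  constructor
  · rintro ⟨φ, hu, hiso, hφ⟩
    have hev := coe_map_ev (A := A) (B := B) hu ((hiso.isNPositive hu 1).mapsPositive le_rfl)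
      (fun i => (opSystem.gen A i).2) (ev_mem_opSystem A) (fun i => congrArg Subtype.val (hφ i))
    have hnorm : ∀ (m : ℕ) (M : Matrix (Fin m) (Fin m) (Coeff d)),
        ‖blockOp (M.map (ev B))‖ = ‖blockOp (M.map (ev A))‖ := by
      intro m M
      have := hiso m (M.map (evSystem A))
      rw [map_coe_evSystem] at this
      rw [← this]
      congr 2
      ext i j : 1
      exact (hev _).symm
    exact ⟨fun m => dominates_of_norm_blockOp_le fun M => (hnorm m M).le,
      fun m => dominates_of_norm_blockOp_le fun M => (hnorm m M).ge⟩
  · rintro ⟨hAB, hBA⟩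
    obtain ⟨φ, hev, hu, hφ⟩ := exists_map_of_ev_eq_zero fun p hp => (hAB 1).ev_eq_zero hp
    refine ⟨φ, hu, fun m M => ?_, hφ⟩
    obtain ⟨N, rfl⟩ := exists_matrix_evSystem M
    rw [map_coe_evSystem]
    convert (norm_blockOp_le_of_dominates hAB N).antisymm (norm_blockOp_le_of_dominates hBA N)
      using 3
    ext i j : 2
    simp [hev, coe_evSystem]

end CompleteIsometry

end MatrixRange

namespace MatrixRange

/-! ### Commuting normal tuples and the joint spectrum. -/

section Commutative

open WeakDual

theorem star_sqrt_mul_sqrt {R : Type*} [CStarAlgebra R] [PartialOrder R] [StarOrderedRing R]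
    {a : R} (ha : 0 ≤ a) : star (CFC.sqrt a) * CFC.sqrt a = a := by
  rw [(CFC.sqrt_nonneg a).isSelfAdjoint.star_eq, CFC.sqrt_mul_sqrt_self a ha]

/-- A matrix over a commutative C*-algebra which is positive at every character is of the form
`R* R`. -/
theorem exists_conjTranspose_mul_self_eq {𝒜 : Type*} [CommCStarAlgebra 𝒜] {m : ℕ}
    (N : Matrix (Fin m) (Fin m) 𝒜)
    (hN : ∀ χ : characterSpace ℂ 𝒜,
      0 ≤ Matrix.toEuclideanCLM (𝕜 := ℂ) (Matrix.of fun i j => χ (N i j))) :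
    ∃ R : Matrix (Fin m) (Fin m) 𝒜, N = R.conjTranspose * R := by
  let F : characterSpace ℂ 𝒜 → (EuclideanSpace ℂ (Fin m) →L[ℂ] EuclideanSpace ℂ (Fin m)) :=
    fun χ => Matrix.toEuclideanCLM (𝕜 := ℂ) (Matrix.of fun i j => χ (N i j))
  have hFc : Continuous F := by
    have h1 : Continuous fun χ : characterSpace ℂ 𝒜 =>
        (Matrix.of fun i j => χ (N i j) : Matrix (Fin m) (Fin m) ℂ) :=
      continuous_pi fun i => continuous_pi fun j => (gelfandTransform ℂ 𝒜 (N i j)).continuous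
    exact (LinearMap.continuous_of_finiteDimensional
      (Matrix.toEuclideanCLM (n := Fin m) (𝕜 := ℂ)).toAlgEquiv.toLinearMap).comp h1
  -- Continuity of the square root makes its entries Gelfand transforms of elements of the algebra.
  have hGc : Continuous fun χ => CFC.sqrt (F χ) :=
    CFC.continuousOn_sqrt.comp_continuous hFc hN
  let S : characterSpace ℂ 𝒜 → Matrix (Fin m) (Fin m) ℂ :=
    fun χ => (Matrix.toEuclideanCLM (𝕜 := ℂ)).symm (CFC.sqrt (F χ))
  have hSc : ∀ i j, Continuous fun χ => S χ i j := by
    intro i j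
    simp only [S, toEuclideanCLM_symm_apply]
    fun_prop
  have hS : ∀ χ, (S χ).conjTranspose * S χ = Matrix.of fun i j => χ (N i j) := by
    intro χ
    apply EquivLike.injective (Matrix.toEuclideanCLM (n := Fin m) (𝕜 := ℂ))
    rw [← Matrix.star_eq_conjTranspose, map_mul, map_star, StarAlgEquiv.apply_symm_apply,
      star_sqrt_mul_sqrt (hN χ)]
  let R : Matrix (Fin m) (Fin m) 𝒜 := Matrix.of fun i j =>
    (gelfandStarTransform 𝒜).symm ⟨fun χ => S χ i j, hSc i j⟩
  have hR : ∀ (χ : characterSpace ℂ 𝒜) i j, χ (R i j) = S χ i j := by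
    intro χ i j
    have h1 : gelfandStarTransform 𝒜 (R i j) = ⟨fun χ => S χ i j, hSc i j⟩ :=
      StarAlgEquiv.apply_symm_apply _ _
    exact congrArg (fun f => f χ) h1
  refine ⟨R, ?_⟩
  ext i j
  apply (gelfandStarTransform 𝒜).injective
  ext χ
  change χ (N i j) = χ ((R.conjTranspose * R) i j)
  have h1 := congrFun (congrFun (hS χ) i) j
  simp only [Matrix.mul_apply, Matrix.conjTranspose_apply, Matrix.of_apply] at h1
  simp only [Matrix.mul_apply, Matrix.conjTranspose_apply, map_sum, map_mul, map_star, hR, h1]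

variable {H : Type*} [NormedAddCommGroup H] [InnerProductSpace ℂ H] [CompleteSpace H]
variable {K : Type*} [NormedAddCommGroup K] [InnerProductSpace ℂ K] [CompleteSpace K]
variable {d : ℕ} {A : Fin d → H →L[ℂ] H} {B : Fin d → K →L[ℂ] K}

theorem isAccretive_conjTranspose_mul_self {ι : Type*} [Fintype ι] (R : Matrix ι ι (K →L[ℂ] K)) :
    IsAccretive (R.conjTranspose * R) := by
  intro x
  have h : ∑ i, ∑ j, inner ℂ (x i) ((R.conjTranspose * R) i j (x j))
      = ∑ k, inner ℂ (∑ i, R k i (x i)) (∑ j, R k j (x j)) := by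
    simp only [Matrix.mul_apply, Matrix.conjTranspose_apply, sum_apply, inner_sum, sum_inner,
      mul_apply_eq_comp, ContinuousLinearMap.star_eq_adjoint,
      ContinuousLinearMap.adjoint_inner_right]
    rw [Finset.sum_comm]
    conv_rhs => rw [Finset.sum_comm]
    exact Finset.sum_congr rfl fun j _ => Finset.sum_comm
  rw [h, Complex.re_sum]
  refine Finset.sum_nonneg fun k _ => ?_
  rw [re_inner_self]
  positivity

theorem mul_comm_cstarAlg (hn : ∀ i, IsStarNormal (B i)) (hc : ∀ i j, Commute (B i) (B j))
    (a b : cstarAlg B) : a * b = b * a := by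
  have h1 : IsMulCommutative (StarAlgebra.adjoin ℂ (Set.range B)) := by
    apply StarAlgebra.isMulCommutative_adjoin
    · rintro _ ⟨i, rfl⟩ _ ⟨j, rfl⟩
      exact hc i j
    · rintro _ ⟨i, rfl⟩ _ ⟨j, rfl⟩
      -- Fuglede's theorem.
      exact (hn j).commute_star_right (hc i j)
  exact (StarSubalgebra.commRingTopologicalClosure _ fun x y => mul_comm' x y).mul_comm a b

theorem coe_ev_cstarAlg (B : Fin d → K →L[ℂ] K) (p : Coeff d) :
    ((ev (cstarAlg.gen B) p : cstarAlg B) : K →L[ℂ] K) = ev B p :=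
  map_ev (cstarAlg B).subtype.toAlgHom.toLinearMap rfl (fun _ => rfl) (fun _ => rfl) p

theorem ev_matrixOps_toOneByOne (z : Fin d → ℂ) (p : Coeff d) :
    ev (matrixOps (toOneByOne z)) p = ev z p • 1 := by
  have h : ∀ c : ℂ, (Matrix.toEuclideanCLM (𝕜 := ℂ)) !![c]
      = c • (1 : EuclideanSpace ℂ (Fin 1) →L[ℂ] EuclideanSpace ℂ (Fin 1)) := by
    intro c
    rw [← map_one (Matrix.toEuclideanCLM (n := Fin 1) (𝕜 := ℂ)), ← map_smul]
    congr 1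
    ext i j
    fin_cases i
    fin_cases j
    simp
  have hz : ∀ i, LinearMap.toSpanSingleton ℂ
      (EuclideanSpace ℂ (Fin 1) →L[ℂ] EuclideanSpace ℂ (Fin 1)) 1 (z i)
        = matrixOps (toOneByOne z) i := fun i => (h (z i)).symm
  exact (map_ev _ (one_smul ℂ _) hz (fun i => by
    rw [← hz, LinearMap.toSpanSingleton_apply, LinearMap.toSpanSingleton_apply, star_smul,
      star_one]) p).symm

instance isClosed_cstarAlg : IsClosed (cstarAlg B : Set (K →L[ℂ] K)) :=
  StarSubalgebra.isClosed_topologicalClosure _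

theorem map_ev_character (χ : characterSpace ℂ (cstarAlg B)) (p : Coeff d) :
    χ (ev (cstarAlg.gen B) p) = ev (fun i => χ (cstarAlg.gen B i)) p := by
  simp only [ev_apply, map_add, map_sum, map_smul, map_one, map_star]

theorem norm_character_add_le (χ : characterSpace ℂ (cstarAlg B)) (p : Coeff d) (c : ℂ) :
    ‖ev (fun i => χ (cstarAlg.gen B i)) p + c‖ ≤ ‖ev B p + c • 1‖ := by
  have h1 := AlgHom.norm_apply_le_self_mul_norm_one χ (ev (cstarAlg.gen B) p + c • 1)
  rw [map_add, map_smul, map_one, map_ev_character, smul_eq_mul, mul_one] at h1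
  refine h1.trans ?_
  have h2 : ‖(1 : cstarAlg B)‖ ≤ 1 := ContinuousLinearMap.norm_id_le
  have h3 : ‖ev (cstarAlg.gen B) p + c • 1‖ = ‖ev B p + c • 1‖ := by
    rw [← coe_ev_cstarAlg]
    rfl
  rw [h3]
  exact mul_le_of_le_one_right (norm_nonneg _) h2

theorem inner_ev_toOneByOne (z : Fin d → ℂ) (p : Coeff d) (x y : EuclideanSpace ℂ (Fin 1)) :
    inner ℂ x (ev (matrixOps (toOneByOne z)) p y) = star (x 0) * y 0 * ev z p := by
  rw [ev_matrixOps_toOneByOne, smul_apply, one_apply_eq_self, inner_smul_right, PiLp.inner_apply]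
  simp
  ring

/-- Characters are unital and contractive, so the value of `p` lies in every disc of
`re_nonneg_of_norm_add_le`; domination at size `1` suffices for membership. -/
theorem toOneByOne_mem_of_mem_jointSpectrum {z : Fin d → ℂ} (hz : z ∈ jointSpectrum B) :
    toOneByOne z ∈ matrixRangeLevel 1 B := by
  obtain ⟨χ, hχ⟩ := hz
  obtain rfl : (fun i => χ (cstarAlg.gen B i)) = z := funext hχ
  rw [mem_matrixRangeLevel_iff]
  intro M hM x
  have h1 : 0 ≤ (ev (fun i => χ (cstarAlg.gen B i)) (M 0 0)).re := by
    refine re_nonneg_of_norm_add_le (T := ev B (M 0 0)) (fun y => ?_)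
      (norm_character_add_le χ (M 0 0))
    simpa using hM fun _ => y
  have h2 : star (x 0 0) * x 0 0 = ((Complex.normSq (x 0 0) : ℝ) : ℂ) :=
    (Complex.normSq_eq_conj_mul_self).symm
  simp only [Fin.sum_univ_one, Matrix.map_apply, inner_ev_toOneByOne]
  rw [h2, Complex.re_ofReal_mul]
  exact mul_nonneg (Complex.normSq_nonneg _) h1

theorem isAccretive_of_forall_character (hn : ∀ i, IsStarNormal (B i))
    (hc : ∀ i j, Commute (B i) (B j)) {m : ℕ} {M : Matrix (Fin m) (Fin m) (Coeff d)}
    (hM : ∀ χ : characterSpace ℂ (cstarAlg B), (blockOp (M.map (ev (matrixOps (toOneByOne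
      fun i => χ (cstarAlg.gen B i)))))).IsPositive) : IsAccretive (M.map (ev B)) := by
  let _ : CommCStarAlgebra (cstarAlg B) :=
    { StarSubalgebra.cstarAlgebra (cstarAlg B) with mul_comm := mul_comm_cstarAlg hn hc }
  obtain ⟨R, hR⟩ := exists_conjTranspose_mul_self_eq (M.map (ev (cstarAlg.gen B))) (by
    intro χ
    rw [ContinuousLinearMap.nonneg_iff_isPositive, isPositive_iff_re_inner]
    intro c hc x
    have h1 := isPositive_blockOp_iff.1 (hM χ) c hc fun i => EuclideanSpace.single 0 (x i)
    rw [smul_apply, inner_smul_right, inner_toEuclideanCLM]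
    simp only [Matrix.smul_apply, smul_apply, inner_smul_right, Matrix.map_apply,
      inner_ev_toOneByOne, ← Finset.mul_sum] at h1
    simp only [Matrix.of_apply, Matrix.map_apply]
    simpa [map_ev_character] using h1)
  have h2 : M.map (ev B) = (R.map (fun a => (a : K →L[ℂ] K))).conjTranspose
      * R.map (fun a => (a : K →L[ℂ] K)) := by
    ext i j : 1
    rw [Matrix.map_apply, ← coe_ev_cstarAlg]
    have := congrArg Subtype.val (congrFun (congrFun hR i) j)
    rw [Matrix.map_apply] at this
    refine this.trans ?_
    simp [Matrix.mul_apply]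
  rw [h2]
  exact isAccretive_conjTranspose_mul_self _

/-- A point of `W_1(A)` comes from a completely positive functional, so it is dominated at every
size `m`, not just at `1`. Passing to `M + M*` supplies the positivity needed at each character. -/
theorem dominates_of_jointSpectrum_subset (hn : ∀ i, IsStarNormal (B i))
    (hc : ∀ i j, Commute (B i) (B j))
    (h : ∀ z ∈ jointSpectrum B, toOneByOne z ∈ matrixRangeLevel 1 A) (m : ℕ) :
    Dominates (Fin m) A B := by
  intro M hM
  have h1 := hM.isPositive_add_conjTranspose
  rw [← map_ev_matrixAdj, ← Matrix.map_add _ (map_add (ev A))] at h1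
  rw [← isAccretive_add_conjTranspose, ← map_ev_matrixAdj, ← Matrix.map_add _ (map_add (ev B))]
  exact isAccretive_of_forall_character hn hc fun χ =>
    (dominates_of_mem_matrixRangeLevel (h _ ⟨χ, fun _ => rfl⟩) m).isPositive h1

end Commutative

end MatrixRange

open MatrixRange in
theorem theorem4p1 {H : Type*} [NormedAddCommGroup H] [InnerProductSpace ℂ H] [CompleteSpace H]
    {K : Type*} [NormedAddCommGroup K] [InnerProductSpace ℂ K] [CompleteSpace K] {d : ℕ}
    (A : Fin d → H →L[ℂ] H) (B : Fin d → K →L[ℂ] K) :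
    (∀ n : ℕ, 1 ≤ n →
      (∃ φ : (opSystem A).toSubmodule →ₗ[ℂ] (opSystem B).toSubmodule,
        IsUnital φ ∧ IsNPositive n φ ∧ ∀ i, φ (opSystem.gen A i) = opSystem.gen B i) →
      matrixRangeLevel n B ⊆ matrixRangeLevel n A) ∧
    ((∃ φ : (opSystem A).toSubmodule →ₗ[ℂ] (opSystem B).toSubmodule,
        IsUCP φ ∧ ∀ i, φ (opSystem.gen A i) = opSystem.gen B i) ↔
      matrixRange B ⊆ matrixRange A) ∧
    ((∀ i, IsStarNormal (B i)) → (∀ i j, Commute (B i) (B j)) →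
      (matrixRange B ⊆ matrixRange A ↔
        ∀ z ∈ jointSpectrum B, toOneByOne z ∈ matrixRangeLevel 1 A) ∧
      (matrixRange B ⊆ matrixRange A ↔ matrixRangeLevel 1 B ⊆ matrixRangeLevel 1 A)) ∧
    ((∃ φ : (opSystem A).toSubmodule →ₗ[ℂ] (opSystem B).toSubmodule,
        IsUnital φ ∧ IsCompletelyIsometric φ ∧ ∀ i, φ (opSystem.gen A i) = opSystem.gen B i) ↔
      matrixRange B = matrixRange A) := by
  have hsub : matrixRange B ⊆ matrixRange A → matrixRangeLevel 1 B ⊆ matrixRangeLevel 1 A :=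
    fun h => matrixRange_subset_iff.1 h 1 le_rfl
  refine ⟨fun n hn h => matrixRangeLevel_subset_of_dominates ((exists_isNPositive_iff hn).1 h),
    exists_isUCP_iff.trans matrixRange_subset_iff_dominates.symm, fun hn hc => ?_,
    exists_completelyIsometric_iff⟩
  have hspec : (∀ z ∈ jointSpectrum B, toOneByOne z ∈ matrixRangeLevel 1 A) →
      matrixRange B ⊆ matrixRange A := fun h =>
    matrixRange_subset_iff_dominates.2 (dominates_of_jointSpectrum_subset hn hc h)
  exact ⟨⟨fun h z hz => hsub h (toOneByOne_mem_of_mem_jointSpectrum hz), hspec⟩,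
    hsub, fun h => hspec fun z hz => h (toOneByOne_mem_of_mem_jointSpectrum hz)⟩
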